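/- An operator space is a (closed) linear subspace $X\subset B(H)$ of the bounded operators on a complex Hilbert space $H$; for $N\ge1$, $M_N(X)$ (the $N\times N$ matrices with entries in $X$) carries the norm inherited from $M_N(B(H))=B(H\oplus\cdots\oplus H)$. For a linear map $u:E\to F$ between operator spaces let $u_N=\mathrm{Id}\otimes u:M_N(E)\to M_N(F)$, and let $d_N(E,F)=\inf\|u_N\|\,\|(u^{-1})_N\|$, the infimum being over all isomorphisms $u:E\to F$ (and $d_N(E,F)=\infty$ if there are none). For a finite dimensional operator space $E$, $N\ge 1$ and $C>0$, let $k_E(N,C)$ be the smallest integer $k\ge1$ such that there is a subspace $F$ of $M_N\oplus\cdots\oplus M_N$ ($k$ copies of the complex $N\times N$ matrices, acting block-diagonally) with $d_N(E,F)\le C$ (and $k_E(N,C)=\infty$ if there is no such $k$). (i) If $E$ is an $n$-dimensional operator space, then for all $0<\delta<1$ and all $N\ge1$ $$k_E\big(N,(1-\delta)^{-1}\big)\le (1+2\delta^{-1})^{2nN^2}.$$ (ii) Therefore, for every operator space $X$, every finite dimensional subspace $E\subset X$ and every $C>1$, $$\limsup_{N\to\infty}\frac{\log k_E(N,C)}{N^2}<\infty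 .$$ (iii) Growth of order $\exp(b\,nN^2)$ is therefore the largest possible: for every $C>1$ there is a number $b>0$, depending only on $C$, such that $k_E(N,C)\le \exp(b\,nN^2)$ for all $n$, all $n$-dimensional operator spaces $E$ and all $N\ge1$. -/

import Mathlib

open scoped ENNReal

universe u v

namespace OpSpace


/-- The bounded operators on a Hilbert space. An operator space is a subspace of some `B H`. -/
abbrev B (H : Type u) [NormedAddCommGroup H] [InnerProductSpace ℂ H] : Type u := H →L[ℂ] H

/-- The Hilbert space direct sum of `N` copies of `H`. -/
abbrev HPow (N : ℕ) (H : Type u) [NormedAddCommGroup H] [InnerProductSpace ℂ H] : Type u :=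
  PiLp 2 (fun _ : Fin N => H)

section

variable {H : Type u} [NormedAddCommGroup H] [InnerProductSpace ℂ H]
variable {K : Type v} [NormedAddCommGroup K] [InnerProductSpace ℂ K]

/-- The operator on `H ⊕ ⋯ ⊕ H` given by an `N × N` matrix with entries in `B H`. -/
noncomputable def matOp {N : ℕ} (x : Matrix (Fin N) (Fin N) (B H)) : B (HPow N H) :=
  ((PiLp.continuousLinearEquiv 2 ℂ (fun _ : Fin N => H)).symm :
      (Fin N → H) →L[ℂ] HPow N H).comp
    (ContinuousLinearMap.pi fun i => ∑ j, (x i j).comp (PiLp.proj 2 (fun _ : Fin N => H) j))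

theorem matOp_apply {N : ℕ} (x : Matrix (Fin N) (Fin N) (B H)) (ξ : HPow N H) (i : Fin N) :
    matOp x ξ i = ∑ j, x i j (ξ j) := by
  simp [matOp]

/-- The norm of `M_N(E)` for an operator space `E ⊆ B H`, inherited from
`M_N(B H) = B (H ⊕ ⋯ ⊕ H)`. -/
noncomputable def matNorm {E : Submodule ℂ (B H)} {N : ℕ} (x : Matrix (Fin N) (Fin N) E) : ℝ :=
  ‖matOp (x.map fun e => (e : B H))‖

/-- The norm of `u_N = Id ⊗ u : M_N(E) → M_N(F)`, the map that applies `u` to each entry. -/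
noncomputable def ampNorm {E : Submodule ℂ (B H)} {F : Submodule ℂ (B K)} (N : ℕ)
    (u : E →L[ℂ] F) : ℝ≥0∞ :=
  ⨆ (x : Matrix (Fin N) (Fin N) E) (_ : matNorm x ≤ 1), ENNReal.ofReal (matNorm (x.map u))

/-- `d_N(E, F)`: the infimum of `‖u_N‖ ‖(u⁻¹)_N‖` over all isomorphisms `u : E → F`,
which is `∞` if there are none. -/
noncomputable def dist (N : ℕ) (E : Submodule ℂ (B H)) (F : Submodule ℂ (B K)) : ℝ≥0∞ :=
  ⨅ u : E ≃L[ℂ] F, ampNorm N (u : E →L[ℂ] F) * ampNorm N (u.symm : F →L[ℂ] E)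

end

/-- The Hilbert space on which the direct sum of `k` copies of `M_N` acts. -/
abbrev SumSpace (N k : ℕ) : Type := HPow k (EuclideanSpace ℂ (Fin N))

/-- The operator space `M_N ⊕ ⋯ ⊕ M_N` (`k` summands), as the space of
block diagonal operators. -/
def matSum (N k : ℕ) : Submodule ℂ (B (SumSpace N k)) where
  carrier := {T | ∃ a : Fin k → B (EuclideanSpace ℂ (Fin N)), ∀ ξ i, T ξ i = a i (ξ i)}
  zero_mem' := ⟨0, by simp⟩
  add_mem' := by
    rintro S T ⟨a, ha⟩ ⟨b, hb⟩
    exact ⟨a + b, fun ξ i => by simp [ha, hb]⟩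
  smul_mem' := by
    rintro c T ⟨a, ha⟩
    exact ⟨c • a, fun ξ i => by simp [ha]⟩

/-- `k_E(N, C)`: the smallest integer `k ≥ 1` such that `d_N(E, F) ≤ C` for some subspace `F` of
the direct sum of `k` copies of `M_N`; it is `∞` if there is none. -/
noncomputable def kE {H : Type u} [NormedAddCommGroup H] [InnerProductSpace ℂ H]
    (E : Submodule ℂ (B H)) (N : ℕ) (C : ℝ) : ℕ∞ :=
  ⨅ (k : ℕ) (_ : 1 ≤ k ∧ ∃ F : Submodule ℂ (B (SumSpace N k)),
      F ≤ matSum N k ∧ dist N E F ≤ ENNReal.ofReal C), (k : ℕ∞)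

end OpSpace

/-!
Let `V = M_N(E)`, a normed space of real dimension `2 n N²`. A vector of `ℂ^N ⊗ H` has only `N`
components, and these span a subspace of dimension at most `N`; hence the norm of each `z ∈ M_N(E)`
is approximated by that of `(φ_z)_N z`, where `φ_z(e) = R e S` is a compression with contractions
`R : H → ℂ^N` and `S : ℂ^N → H`. If `z` runs over an `ε`-net of the unit sphere of `V`, the
compressions `φ_z` almost recover, up to an error `ε`, the norm of every `x ∈ V`, so that
`e ↦ ⨁ φ_z(e)` embeds `E` into as many copies of `M_N` as there are points in the net. Comparing
volumes, such a net may be chosen with at most `(1 + 2 / ε) ^ (2 n N²)` points. Approximating norms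
costs an arbitrarily small amount, which is absorbed by using `ε < δ` and then letting `ε → δ`.
-/

namespace OpSpace

open Metric Module

open scoped NNReal

section Net

open MeasureTheory

variable {V : Type*} [NormedAddCommGroup V] [NormedSpace ℝ V] [FiniteDimensional ℝ V]

theorem encard_le_of_isSeparated_of_subset_closedBall {C : Set V} {x : V} {R : ℝ} {ε : ℝ≥0}
    (hε : 0 < ε) (hR : 0 ≤ R) (hC : IsSeparated ε C) (hsub : C ⊆ closedBall x R) :
    (C.encard : ℝ≥0∞) ≤ ENNReal.ofReal ((1 + 2 * R * (ε : ℝ)⁻¹) ^ finrank ℝ V) := by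
  borelize V
  let μ : Measure V := Measure.addHaar
  have hε' : (0 : ℝ) < ε := hε
  have hdisj : Pairwise (Function.onFun Disjoint fun c : C => ball (c : V) (ε / 2)) := by
    intro c d hcd
    refine ball_disjoint_ball ?_
    have hlt : (ε : ℝ≥0∞) < edist (c : V) d := hC c.2 d.2 (Subtype.coe_ne_coe.2 hcd)
    rw [edist_nndist, ENNReal.coe_lt_coe] at hlt
    rw [add_halves]
    exact hlt.le
  have hunion : (⋃ c : C, ball (c : V) (ε / 2)) ⊆ ball x (R + ε / 2) :=
    Set.iUnion_subset fun c => ball_subset_ball' <| by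
      linarith [mem_closedBall.1 (hsub c.2)]
  have hvol : C.encard * μ (ball 0 (ε / 2)) ≤
      ENNReal.ofReal ((1 + 2 * R * (ε : ℝ)⁻¹) ^ finrank ℝ V) * μ (ball 0 (ε / 2)) :=
    calc C.encard * μ (ball 0 (ε / 2))
        = ∑' c : C, μ (ball (c : V) (ε / 2)) := by
          simp only [Measure.addHaar_ball_center, ENNReal.tsum_set_const]
      _ ≤ μ (⋃ c : C, ball (c : V) (ε / 2)) :=
          tsum_meas_le_meas_iUnion_of_disjoint μ (fun _ => measurableSet_ball) hdisj
      _ ≤ μ (ball x (R + ε / 2)) := measure_mono hunion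
      _ = μ (ball x ((1 + 2 * R * (ε : ℝ)⁻¹) * (ε / 2))) := by
          congr 2
          field_simp
          ring
      _ = _ := μ.addHaar_ball_mul_of_pos x (by positivity) _
  exact (ENNReal.mul_le_mul_iff_left (measure_ball_pos μ 0 (half_pos hε')).ne'
    measure_ball_lt_top.ne).1 hvol

theorem coveringNumber_le_of_subset_closedBall {A : Set V} {x : V} {R : ℝ} {ε : ℝ≥0}
    (hε : 0 < ε) (hR : 0 ≤ R) (hA : A ⊆ closedBall x R) :
    (coveringNumber ε A : ℝ≥0∞) ≤ ENNReal.ofReal ((1 + 2 * R * (ε : ℝ)⁻¹) ^ finrank ℝ V) :=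
  calc (coveringNumber ε A : ℝ≥0∞) ≤ packingNumber ε A :=
        ENat.toENNReal_le.2 (coveringNumber_le_packingNumber ε A)
    _ ≤ _ := by
        simp only [packingNumber, ENat.toENNReal_iSup]
        exact iSup₂_le fun C hCA => iSup_le fun hC =>
          encard_le_of_isSeparated_of_subset_closedBall hε hR hC (hCA.trans hA)

end Net

theorem exists_le_norm_of_isCover_sphere {𝕜 V W : Type*} [RCLike 𝕜] [NormedAddCommGroup V]
    [NormedSpace 𝕜 V] [Nontrivial V] [SeminormedAddCommGroup W] [Module 𝕜 W] [NormSMulClass 𝕜 W]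
    {S : Set V} {ε : ℝ≥0} {c : ℝ} (hS : IsCover ε (sphere 0 1) S) (T : S → V →ₗ[𝕜] W)
    (hT : ∀ z x, ‖T z x‖ ≤ ‖x‖) (hc : ∀ z : S, c ≤ ‖T z z‖) (x : V) :
    ∃ z, (c - ε) * ‖x‖ ≤ ‖T z x‖ := by
  have hunit : ∀ y : V, ‖y‖ = 1 → ∃ z, c - ε ≤ ‖T z y‖ := by
    intro y hy
    obtain ⟨z, hz, hyz⟩ := hS (mem_sphere_zero_iff_norm.2 hy)
    have hdist : ‖y - z‖ ≤ ε := by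
      rw [← dist_eq_norm]
      exact_mod_cast edist_le_coe.1 hyz
    have hsub : ‖T ⟨z, hz⟩ z‖ - ‖T ⟨z, hz⟩ y‖ ≤ ‖T ⟨z, hz⟩ (y - z)‖ := by
      rw [map_sub, norm_sub_rev]
      exact norm_sub_norm_le _ _
    exact ⟨⟨z, hz⟩, by linarith [hc ⟨z, hz⟩, hT ⟨z, hz⟩ (y - z)]⟩
  rcases eq_or_ne x 0 with rfl | hx
  · obtain ⟨w, hw⟩ := exists_ne (0 : V)
    obtain ⟨z, -⟩ := hunit _ (norm_smul_inv_norm (𝕜 := 𝕜) hw)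
    exact ⟨z, by simp⟩
  · obtain ⟨z, hz⟩ := hunit _ (norm_smul_inv_norm (𝕜 := 𝕜) hx)
    refine ⟨z, ?_⟩
    rwa [map_smul, norm_smul, norm_inv, RCLike.norm_ofReal, abs_norm, inv_mul_eq_div,
      le_div_iff₀ (norm_pos_iff.2 hx)] at hz

section Factorization

variable {𝕜 H K : Type*} [RCLike 𝕜] [NormedAddCommGroup H] [InnerProductSpace 𝕜 H]
  [NormedAddCommGroup K] [InnerProductSpace 𝕜 K]

theorem exists_contractions_comp_eq_self_of_mem (S : Submodule 𝕜 H) [FiniteDimensional 𝕜 S]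
    (hS : finrank 𝕜 S ≤ finrank 𝕜 K) :
    ∃ (R : H →L[𝕜] K) (V : K →L[𝕜] H), ‖R‖ ≤ 1 ∧ ‖V‖ ≤ 1 ∧ ∀ x ∈ S, V (R x) = x := by
  obtain ⟨f, hf⟩ := exists_linearIndependent_of_le_finrank hS
  let T : Submodule 𝕜 K := Submodule.span 𝕜 (Set.range f)
  have : FiniteDimensional 𝕜 T := FiniteDimensional.span_of_finite 𝕜 (Set.finite_range f)
  have hT : finrank 𝕜 S = finrank 𝕜 T := by
    rw [finrank_span_eq_card hf, Fintype.card_fin]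
  let e : S ≃ₗᵢ[𝕜] T := (stdOrthonormalBasis 𝕜 S).equiv (stdOrthonormalBasis 𝕜 T) (finCongr hT)
  refine ⟨(T.subtypeₗᵢ.comp e.toLinearIsometry).toContinuousLinearMap ∘L
      S.orthogonalProjectionOnto,
    (S.subtypeₗᵢ.comp e.symm.toLinearIsometry).toContinuousLinearMap ∘L
      T.orthogonalProjectionOnto, ?_, ?_, fun x hx => ?_⟩
  · rw [LinearIsometry.norm_toContinuousLinearMap_comp]
    exact S.orthogonalProjectionOnto_norm_le
  · rw [LinearIsometry.norm_toContinuousLinearMap_comp]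
    exact T.orthogonalProjectionOnto_norm_le
  · lift x to S using hx
    simp

theorem exists_contractions_comp_eq_self {ι : Type*} [Fintype ι]
    (hι : Fintype.card ι ≤ finrank 𝕜 K) (ξ : ι → H) :
    ∃ (R : H →L[𝕜] K) (V : K →L[𝕜] H), ‖R‖ ≤ 1 ∧ ‖V‖ ≤ 1 ∧ ∀ i, V (R (ξ i)) = ξ i := by
  have : FiniteDimensional 𝕜 (Submodule.span 𝕜 (Set.range ξ)) :=
    FiniteDimensional.span_of_finite 𝕜 (Set.finite_range ξ)
  obtain ⟨R, V, hR, hV, hVR⟩ := exists_contractions_comp_eq_self_of_mem (K := K)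
    (Submodule.span 𝕜 (Set.range ξ)) ((finrank_range_le_card ξ).trans hι)
  exact ⟨R, V, hR, hV, fun i => hVR _ (Submodule.subset_span ⟨i, rfl⟩)⟩

end Factorization

section DirectSum

variable {H : Type u} [NormedAddCommGroup H] [InnerProductSpace ℂ H]
variable {K : Type v} [NormedAddCommGroup K] [InnerProductSpace ℂ K]

/-- The block diagonal operator `T₁ ⊕ ⋯ ⊕ T_k`. -/
noncomputable def directSum {k : ℕ} (T : Fin k → H →L[ℂ] K) : HPow k H →L[ℂ] HPow k K :=
  (PiLp.continuousLinearEquiv 2 ℂ fun _ : Fin k => K).symm.toContinuousLinearMap ∘L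
    ContinuousLinearMap.piMap T ∘L
      (PiLp.continuousLinearEquiv 2 ℂ fun _ : Fin k => H).toContinuousLinearMap

@[simp]
theorem directSum_apply {k : ℕ} (T : Fin k → H →L[ℂ] K) (ξ : HPow k H) (i : Fin k) :
    directSum T ξ i = T i (ξ i) := rfl

theorem norm_directSum_le {k : ℕ} {T : Fin k → H →L[ℂ] K} {c : ℝ} (hc : 0 ≤ c)
    (hT : ∀ i, ‖T i‖ ≤ c) : ‖directSum T‖ ≤ c := by
  refine ContinuousLinearMap.opNorm_le_bound _ hc fun ξ => le_of_sq_le_sq ?_ (by positivity)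
  rw [mul_pow, PiLp.norm_sq_eq_of_L2, PiLp.norm_sq_eq_of_L2, Finset.mul_sum]
  gcongr with i
  rw [directSum_apply, ← mul_pow]
  gcongr
  exact (T i).le_of_opNorm_le (hT i) _

theorem norm_directSum_apply_le {k : ℕ} {T : Fin k → H →L[ℂ] K} (hT : ∀ i, ‖T i‖ ≤ 1)
    (ξ : HPow k H) : ‖directSum T ξ‖ ≤ ‖ξ‖ := by
  simpa only [one_mul] using
    (directSum T).le_of_opNorm_le (norm_directSum_le zero_le_one hT) ξ

theorem norm_le_norm_directSum {k : ℕ} (T : Fin k → H →L[ℂ] K) (i : Fin k) :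
    ‖T i‖ ≤ ‖directSum T‖ := by
  refine ContinuousLinearMap.opNorm_le_bound _ (norm_nonneg (directSum T)) fun v => ?_
  calc ‖T i v‖ = ‖directSum T (PiLp.single 2 i v) i‖ := by simp
    _ ≤ ‖directSum T (PiLp.single 2 i v)‖ := PiLp.norm_apply_le _ i
    _ ≤ ‖directSum T‖ * ‖v‖ := by
        simpa using (directSum T).le_opNorm (PiLp.single 2 i v)

/-- The canonical identification of `ℂ^N ⊗ (ℂ^k ⊗ H)` with `ℂ^k ⊗ (ℂ^N ⊗ H)`, which turns matrices
of block diagonal operators into block diagonal matrices. -/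
noncomputable def swapHPow (N k : ℕ) (H : Type u) [NormedAddCommGroup H] [InnerProductSpace ℂ H] :
    HPow N (HPow k H) ≃ₗᵢ[ℂ] HPow k (HPow N H) where
  toFun ζ := WithLp.toLp 2 fun i => WithLp.toLp 2 fun p => ζ p i
  invFun ζ := WithLp.toLp 2 fun p => WithLp.toLp 2 fun i => ζ i p
  map_add' _ _ := rfl
  map_smul' _ _ := rfl
  left_inv _ := rfl
  right_inv _ := rfl
  norm_map' ζ := by
    refine (sq_eq_sq₀ (norm_nonneg _) (norm_nonneg _)).1 ?_
    simp only [PiLp.norm_sq_eq_of_L2]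
    exact Finset.sum_comm

@[simp]
theorem swapHPow_apply {N k : ℕ} (ζ : HPow N (HPow k H)) (i : Fin k) (p : Fin N) :
    swapHPow N k H ζ i p = ζ p i := rfl

end DirectSum

section Amplification

variable {M : Type*} [AddCommGroup M] [Module ℂ M]
variable {H : Type u} [NormedAddCommGroup H] [InnerProductSpace ℂ H]
variable {K : Type v} [NormedAddCommGroup K] [InnerProductSpace ℂ K]

/-- The amplification `φ_N = Id ⊗ φ` of a map `φ : M → B K`, with values in
`M_N(B K) = B(K ⊕ ⋯ ⊕ K)`. -/
noncomputable def amplification (N : ℕ) (φ : M →ₗ[ℂ] B K) :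
    Matrix (Fin N) (Fin N) M →ₗ[ℂ] B (HPow N K) where
  toFun x := matOp (x.map φ)
  map_add' x y := by
    ext ξ i
    simp [matOp_apply, Finset.sum_add_distrib]
  map_smul' c x := by
    ext ξ i
    simp [matOp_apply, Finset.smul_sum]

@[simp]
theorem amplification_apply {N : ℕ} (φ : M →ₗ[ℂ] B K) (x : Matrix (Fin N) (Fin N) M)
    (ξ : HPow N K) (i : Fin N) : amplification N φ x ξ i = ∑ j, φ (x i j) (ξ j) :=
  matOp_apply _ _ _

theorem amplification_injective {N : ℕ} {φ : M →ₗ[ℂ] B K} (hφ : Function.Injective φ) :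
    Function.Injective (amplification N φ) := by
  refine (injective_iff_map_eq_zero _).2 fun x hx => ?_
  ext i j
  refine (map_eq_zero_iff φ hφ).1 (ContinuousLinearMap.ext fun v => ?_)
  have hentry : amplification N φ x (PiLp.single 2 j v) i = φ (x i j) v := by
    rw [amplification_apply, Finset.sum_eq_single j (fun q _ hq => by simp [hq]) (by simp)]
    simp
  rw [← hentry, hx]
  rfl

/-- The direct sum `e ↦ φ₁(e) ⊕ ⋯ ⊕ φ_k(e)` of operator valued maps. -/
noncomputable def directSumMap {k : ℕ} (φ : Fin k → M →ₗ[ℂ] B K) : M →ₗ[ℂ] B (HPow k K) where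
  toFun e := directSum fun i => φ i e
  map_add' e f := by
    ext ξ i
    simp
  map_smul' c e := by
    ext ξ i
    simp

@[simp]
theorem directSumMap_apply {k : ℕ} (φ : Fin k → M →ₗ[ℂ] B K) (e : M) :
    directSumMap φ e = directSum fun i => φ i e := rfl

theorem directSumMap_mem_matSum {N k : ℕ} (φ : Fin k → M →ₗ[ℂ] B (EuclideanSpace ℂ (Fin N)))
    (e : M) : directSumMap φ e ∈ matSum N k :=
  ⟨fun i => φ i e, fun _ _ => rfl⟩

theorem norm_amplification_directSumMap {N k : ℕ} (φ : Fin k → M →ₗ[ℂ] B K)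
    (x : Matrix (Fin N) (Fin N) M) :
    ‖amplification N (directSumMap φ) x‖ = ‖directSum fun i => amplification N (φ i) x‖ := by
  have hconj : (swapHPow N k K).toLinearIsometry.toContinuousLinearMap ∘L
      amplification N (directSumMap φ) x =
      (directSum fun i => amplification N (φ i) x) ∘L
        (swapHPow N k K).toLinearIsometry.toContinuousLinearMap := by
    ext ζ i p
    simp
  rw [← LinearIsometry.norm_toContinuousLinearMap_comp (swapHPow N k K).toLinearIsometry, hconj]
  exact ContinuousLinearMap.opNorm_comp_linearIsometryEquiv _ (swapHPow N k K)

/-- The compression `e ↦ R e V` by operators `R : H → K` and `V : K → H`. -/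
noncomputable def compression (R : H →L[ℂ] K) (V : K →L[ℂ] H) : B H →ₗ[ℂ] B K where
  toFun e := R ∘L e ∘L V
  map_add' e f := by simp
  map_smul' c e := by simp

@[simp]
theorem compression_apply (R : H →L[ℂ] K) (V : K →L[ℂ] H) (e : B H) :
    compression R V e = R ∘L e ∘L V := rfl

theorem amplification_compression {N : ℕ} (R : H →L[ℂ] K) (V : K →L[ℂ] H)
    (x : Matrix (Fin N) (Fin N) (B H)) :
    amplification N (compression R V) x =
      (directSum fun _ => R) ∘L matOp x ∘L directSum fun _ => V := by
  ext ξ i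
  simp [matOp_apply]

theorem norm_amplification_compression_le {N : ℕ} {R : H →L[ℂ] K} {V : K →L[ℂ] H}
    (hR : ‖R‖ ≤ 1) (hV : ‖V‖ ≤ 1) (x : Matrix (Fin N) (Fin N) (B H)) :
    ‖amplification N (compression R V) x‖ ≤ ‖matOp x‖ := by
  rw [amplification_compression]
  calc _ ≤ ‖directSum fun _ : Fin N => R‖ * (‖matOp x‖ * ‖directSum fun _ : Fin N => V‖) :=
        (ContinuousLinearMap.opNorm_comp_le _ _).trans <| by
          gcongr
          exact ContinuousLinearMap.opNorm_comp_le _ _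
    _ ≤ 1 * (‖matOp x‖ * 1) := by
        gcongr <;> exact norm_directSum_le zero_le_one fun _ => by assumption
    _ = ‖matOp x‖ := by rw [mul_one, one_mul]

theorem exists_lt_norm_amplification_compression {N : ℕ}
    (hN : N ≤ finrank ℂ K) (x : Matrix (Fin N) (Fin N) (B H)) {c : ℝ} (hc : c < ‖matOp x‖) :
    ∃ (R : H →L[ℂ] K) (V : K →L[ℂ] H), ‖R‖ ≤ 1 ∧ ‖V‖ ≤ 1 ∧
      c < ‖amplification N (compression R V) x‖ := by
  obtain ⟨ξ, hξ, hcξ⟩ := (matOp x).exists_lt_apply_of_lt_opNorm hc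
  have hcard : Fintype.card (Fin N) ≤ finrank ℂ K := by rwa [Fintype.card_fin]
  obtain ⟨R₁, V₁, hR₁, hV₁, hfix₁⟩ := exists_contractions_comp_eq_self hcard fun j => ξ j
  obtain ⟨R₂, V₂, hR₂, hV₂, hfix₂⟩ := exists_contractions_comp_eq_self hcard fun i => matOp x ξ i
  have hin : directSum (fun _ => V₁) (directSum (fun _ => R₁) ξ) = ξ := by
    ext j
    exact hfix₁ j
  have hout : directSum (fun _ => V₂) (directSum (fun _ => R₂) (matOp x ξ)) = matOp x ξ := by
    ext i
    exact hfix₂ i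
  refine ⟨R₂, V₁, hR₂, hV₁, ?_⟩
  calc c < ‖matOp x ξ‖ := hcξ
    _ ≤ ‖directSum (fun _ => R₂) (matOp x ξ)‖ := by
        conv_lhs => rw [← hout]
        exact norm_directSum_apply_le (fun _ => hV₂) _
    _ = ‖amplification N (compression R₂ V₁) x (directSum (fun _ => R₁) ξ)‖ := by
        simp only [amplification_compression, ContinuousLinearMap.comp_apply, hin]
    _ ≤ ‖amplification N (compression R₂ V₁) x‖ :=
        ContinuousLinearMap.unit_le_opNorm _ _ <|
          (norm_directSum_apply_le (fun _ => hR₁) ξ).trans hξ.le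

end Amplification

section MatrixNorm

variable {H : Type u} [NormedAddCommGroup H] [InnerProductSpace ℂ H]
variable {K : Type v} [NormedAddCommGroup K] [InnerProductSpace ℂ K]

/-- The norm of `M_N(E)`; by definition `‖x‖ = matNorm x`. Not a global instance, as `Matrix`
carries no preferred norm. -/
noncomputable abbrev matNormedAddCommGroup (E : Submodule ℂ (B H)) (N : ℕ) :
    NormedAddCommGroup (Matrix (Fin N) (Fin N) E) :=
  NormedAddCommGroup.induced _ _ (amplification N E.subtype)
    (amplification_injective E.subtype_injective)

attribute [local instance] matNormedAddCommGroup

/-- The normed space structure of `M_N(E)`. -/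
noncomputable abbrev matNormedSpace (E : Submodule ℂ (B H)) (N : ℕ) :
    NormedSpace ℂ (Matrix (Fin N) (Fin N) E) :=
  NormedSpace.induced ℂ _ _ (amplification N E.subtype)

attribute [local instance] matNormedSpace

variable {E : Submodule ℂ (B H)} {N : ℕ}

theorem ampNorm_le_ofReal {F : Submodule ℂ (B K)} {u : E →L[ℂ] F} {c : ℝ} (hc : 0 ≤ c)
    (hu : ∀ x : Matrix (Fin N) (Fin N) E, matNorm (x.map u) ≤ c * matNorm x) :
    ampNorm N u ≤ ENNReal.ofReal c :=
  iSup₂_le fun x hx => ENNReal.ofReal_le_ofReal <|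
    (hu x).trans (mul_le_of_le_one_right hc hx)

theorem injective_of_le_norm_amplification [NeZero N] {u : E →ₗ[ℂ] B K} {c : ℝ} (hc : 0 < c)
    (hu : ∀ x, c * ‖x‖ ≤ ‖amplification N u x‖) : Function.Injective u := by
  refine (injective_iff_map_eq_zero u).2 fun e he => ?_
  let x : Matrix (Fin N) (Fin N) E := Matrix.of fun _ _ => e
  have hx : amplification N u x = 0 := by
    ext ξ i
    simp [x, he]
  have hx0 : x = 0 := by
    rw [← norm_le_zero_iff]
    refine nonpos_of_mul_nonpos_right ?_ hc
    simpa only [hx, norm_zero] using hu x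
  exact congrFun (congrFun hx0 0) 0

theorem dist_range_le [FiniteDimensional ℂ E] [NeZero N] {u : E →ₗ[ℂ] B K} {c : ℝ} (hc : 0 < c)
    (hle : ∀ x, ‖amplification N u x‖ ≤ ‖x‖) (hge : ∀ x, c * ‖x‖ ≤ ‖amplification N u x‖) :
    dist N E (LinearMap.range u) ≤ ENNReal.ofReal c⁻¹ := by
  let w : E ≃L[ℂ] LinearMap.range u := (LinearEquiv.ofInjective u
    (injective_of_le_norm_amplification hc hge)).toContinuousLinearEquiv
  have hw : ampNorm N (w : E →L[ℂ] LinearMap.range u) ≤ ENNReal.ofReal 1 :=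
    ampNorm_le_ofReal zero_le_one fun x => (hle x).trans_eq (one_mul _).symm
  have hw_symm : ampNorm N (w.symm : LinearMap.range u →L[ℂ] E) ≤ ENNReal.ofReal c⁻¹ := by
    refine ampNorm_le_ofReal (inv_nonneg.2 hc.le) fun y => ?_
    have hy : (y.map w.symm).map w = y := by
      ext1 i j
      exact w.apply_symm_apply (y i j)
    have hlow : c * matNorm (y.map w.symm) ≤ matNorm ((y.map w.symm).map w) := hge _
    rwa [hy, ← le_inv_mul_iff₀ hc] at hlow
  calc dist N E (LinearMap.range u) ≤ _ := iInf_le _ w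
    _ ≤ ENNReal.ofReal 1 * ENNReal.ofReal c⁻¹ := mul_le_mul' hw hw_symm
    _ = ENNReal.ofReal c⁻¹ := by rw [ENNReal.ofReal_one, one_mul]

theorem kE_le_card_of_norming [FiniteDimensional ℂ E] [NeZero N] {ι : Type*} [Fintype ι]
    (φ : ι → E →ₗ[ℂ] B (EuclideanSpace ℂ (Fin N))) {c : ℝ} (hc : 0 < c)
    (hle : ∀ i x, ‖amplification N (φ i) x‖ ≤ ‖x‖)
    (hge : ∀ x, ∃ i, c * ‖x‖ ≤ ‖amplification N (φ i) x‖) :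
    kE E N c⁻¹ ≤ Fintype.card ι := by
  let e := Fintype.equivFin ι
  let u := directSumMap fun i => φ (e.symm i)
  have hu_le : ∀ x, ‖amplification N u x‖ ≤ ‖x‖ := fun x => by
    rw [norm_amplification_directSumMap]
    exact norm_directSum_le (norm_nonneg x) fun i => hle _ x
  have hu_ge : ∀ x, c * ‖x‖ ≤ ‖amplification N u x‖ := fun x => by
    obtain ⟨i, hi⟩ := hge x
    rw [norm_amplification_directSumMap]
    refine hi.trans ?_
    simpa only [e.symm_apply_apply] using
      norm_le_norm_directSum (fun j => amplification N (φ (e.symm j)) x) (e i)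
  have hcard : 1 ≤ Fintype.card ι := Fintype.card_pos_iff.2 ⟨(hge 0).choose⟩
  have hmem : LinearMap.range u ≤ matSum N (Fintype.card ι) := by
    rintro _ ⟨a, rfl⟩
    exact directSumMap_mem_matSum _ a
  exact iInf₂_le _ ⟨hcard, LinearMap.range u, hmem, dist_range_le hc hu_le hu_ge⟩

theorem kE_le_one_of_subsingleton [Subsingleton E] [NeZero N] {c : ℝ} (hc : 0 < c) :
    kE E N c⁻¹ ≤ 1 := by
  have h := kE_le_card_of_norming (E := E) (N := N) (fun _ : Unit => 0) hc
    (fun _ x => by simp [Subsingleton.elim x 0]) (fun x => ⟨(), by simp [Subsingleton.elim x 0]⟩)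
  simpa using h

theorem kE_le_coveringNumber_sphere [FiniteDimensional ℂ E] [Nontrivial E] [NeZero N] {ε : ℝ≥0}
    {δ : ℝ} (hεδ : ε < δ) (hδ : δ < 1) :
    kE E N (1 - δ)⁻¹ ≤ coveringNumber ε (sphere (0 : Matrix (Fin N) (Fin N) E) 1) := by
  by_cases htop : coveringNumber ε (sphere (0 : Matrix (Fin N) (Fin N) E) 1) = ⊤
  · exact htop ▸ le_top
  let S := minimalCover ε (sphere (0 : Matrix (Fin N) (Fin N) E) 1)
  have : Fintype S := finite_minimalCover.fintype
  have hnorm (z : S) : 1 - (δ - ε) < ‖(z : Matrix (Fin N) (Fin N) E)‖ := by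
    rw [mem_sphere_zero_iff_norm.1 (minimalCover_subset z.2)]
    linarith
  choose R V hR hV hRV using fun z : S =>
    exists_lt_norm_amplification_compression (K := EuclideanSpace ℂ (Fin N))
      finrank_euclideanSpace_fin.ge _ (hnorm z)
  let φ (z : S) : E →ₗ[ℂ] B (EuclideanSpace ℂ (Fin N)) := compression (R z) (V z) ∘ₗ E.subtype
  have hφ (z : S) (x : Matrix (Fin N) (Fin N) E) : ‖amplification N (φ z) x‖ ≤ ‖x‖ :=
    norm_amplification_compression_le (hR z) (hV z) _
  have hge (x : Matrix (Fin N) (Fin N) E) : ∃ z, (1 - δ) * ‖x‖ ≤ ‖amplification N (φ z) x‖ := by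
    simpa only [sub_sub, sub_add_cancel] using exists_le_norm_of_isCover_sphere (𝕜 := ℂ)
      (isCover_minimalCover htop) (fun z => amplification N (φ z)) hφ (fun z => (hRV z).le) x
  calc kE E N (1 - δ)⁻¹ ≤ Fintype.card S := kE_le_card_of_norming φ (sub_pos.2 hδ) hφ hge
    _ = S.encard := by rw [Set.encard, ENat.card_eq_coe_fintype_card]
    _ = _ := encard_minimalCover htop

theorem finrank_real_matrix (M : Type*) [AddCommGroup M] [Module ℂ M] (N : ℕ) :
    finrank ℝ (Matrix (Fin N) (Fin N) M) = 2 * finrank ℂ M * N ^ 2 := by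
  rw [finrank_real_of_complex, finrank_matrix, Fintype.card_fin]
  ring

end MatrixNorm

section Growth

variable {H : Type u} [NormedAddCommGroup H] [InnerProductSpace ℂ H]
variable (E : Submodule ℂ (B H)) [FiniteDimensional ℂ E] (N : ℕ) [NeZero N]

attribute [local instance] matNormedAddCommGroup matNormedSpace

theorem kE_le_pow_of_lt {ε δ : ℝ} (hε : 0 < ε) (hεδ : ε < δ) (hδ : δ < 1) :
    (kE E N (1 - δ)⁻¹ : ℝ≥0∞) ≤ ENNReal.ofReal ((1 + 2 * ε⁻¹) ^ (2 * finrank ℂ E * N ^ 2)) := by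
  rcases subsingleton_or_nontrivial E with hE | hE
  · calc (kE E N (1 - δ)⁻¹ : ℝ≥0∞) ≤ ((1 : ℕ∞) : ℝ≥0∞) :=
          ENat.toENNReal_le.2 (kE_le_one_of_subsingleton (sub_pos.2 hδ))
      _ = ENNReal.ofReal ((1 + 2 * ε⁻¹) ^ (2 * finrank ℂ E * N ^ 2)) := by
          simp [finrank_zero_of_subsingleton]
  lift ε to ℝ≥0 using hε.le
  calc (kE E N (1 - δ)⁻¹ : ℝ≥0∞)
      ≤ (coveringNumber ε (sphere (0 : Matrix (Fin N) (Fin N) E) 1) : ℝ≥0∞) :=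
        ENat.toENNReal_le.2 (kE_le_coveringNumber_sphere hεδ hδ)
    _ ≤ ENNReal.ofReal
          ((1 + 2 * 1 * (ε : ℝ)⁻¹) ^ finrank ℝ (Matrix (Fin N) (Fin N) E)) :=
        coveringNumber_le_of_subset_closedBall (NNReal.coe_pos.1 hε) zero_le_one
          sphere_subset_closedBall
    _ = _ := by rw [mul_one, finrank_real_matrix]

theorem kE_le_pow {δ : ℝ} (hδ₀ : 0 < δ) (hδ₁ : δ < 1) :
    (kE E N (1 - δ)⁻¹ : ℝ≥0∞) ≤ ENNReal.ofReal ((1 + 2 * δ⁻¹) ^ (2 * finrank ℂ E * N ^ 2)) := by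
  have hcont : ContinuousAt
      (fun ε : ℝ => ENNReal.ofReal ((1 + 2 * ε⁻¹) ^ (2 * finrank ℂ E * N ^ 2))) δ :=
    ENNReal.continuous_ofReal.continuousAt.comp
      ((continuousAt_const.add (continuousAt_const.mul (continuousAt_inv₀ hδ₀.ne'))).pow _)
  refine ge_of_tendsto (hcont.tendsto.mono_left (nhdsWithin_le_nhds (s := Set.Iio δ))) ?_
  filter_upwards [Ioo_mem_nhdsLT hδ₀] with ε hε
  exact kE_le_pow_of_lt E N hε.1 hε.2 hδ₁

/-- The rate `b` in the bound `exp (b n N²)` for `k_E(N, C)`: it satisfies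
`exp b = (1 + 2 / δ)²` for the `δ` with `(1 - δ)⁻¹ = C`. -/
noncomputable def growthRate (C : ℝ) : ℝ :=
  2 * Real.log (1 + 2 * (1 - C⁻¹)⁻¹)

theorem growthRate_pos {C : ℝ} (hC : 1 < C) : 0 < growthRate C := by
  have hinv : 0 < (1 - C⁻¹)⁻¹ := inv_pos.2 (sub_pos.2 (inv_lt_one_of_one_lt₀ hC))
  exact mul_pos two_pos (Real.log_pos (by linarith))

theorem kE_le_exp {C : ℝ} (hC : 1 < C) :
    (kE E N C : ℝ≥0∞) ≤ ENNReal.ofReal (Real.exp (growthRate C * finrank ℂ E * N ^ 2)) := by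
  have hδ₀ : 0 < 1 - C⁻¹ := sub_pos.2 (inv_lt_one_of_one_lt₀ hC)
  have hδ₁ : 1 - C⁻¹ < 1 := sub_lt_self 1 (by positivity)
  have hbase : 0 < 1 + 2 * (1 - C⁻¹)⁻¹ := by positivity
  calc (kE E N C : ℝ≥0∞) = kE E N (1 - (1 - C⁻¹))⁻¹ := by rw [sub_sub_cancel, inv_inv]
    _ ≤ ENNReal.ofReal ((1 + 2 * (1 - C⁻¹)⁻¹) ^ (2 * finrank ℂ E * N ^ 2)) :=
        kE_le_pow E N hδ₀ hδ₁
    _ = ENNReal.ofReal (Real.exp (growthRate C * finrank ℂ E * N ^ 2)) := by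
        rw [← Real.exp_log (pow_pos hbase _), Real.log_pow, growthRate]
        push_cast
        ring_nf

end Growth

theorem limsup_log_div_le_of_le_exp {α : Type*} {l : Filter α} {f : α → ℝ≥0∞} {g : α → ℝ} {a : ℝ}
    (hg : ∀ᶠ i in l, 0 < g i) (hf : ∀ᶠ i in l, f i ≤ ENNReal.ofReal (Real.exp (a * g i))) :
    Filter.limsup (fun i => ENNReal.log (f i) / (g i : EReal)) l ≤ a := by
  refine Filter.limsup_le_of_le (by isBoundedDefault) ?_
  filter_upwards [hg, hf] with i hgi hfi
  rw [EReal.div_le_iff_le_mul (EReal.coe_pos.2 hgi) (EReal.coe_ne_top _)]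
  calc ENNReal.log (f i) ≤ ENNReal.log (ENNReal.ofReal (Real.exp (a * g i))) :=
        ENNReal.log_monotone hfi
    _ = (g i : EReal) * a := by
        rw [ENNReal.log_ofReal_of_pos (Real.exp_pos _), Real.log_exp, mul_comm, EReal.coe_mul]

end OpSpace

theorem mainTheorem9_general :
    (∀ (H : Type u) [NormedAddCommGroup H] [InnerProductSpace ℂ H]
      (E : Submodule ℂ (OpSpace.B H)) [FiniteDimensional ℂ E] (n : ℕ),
      Module.finrank ℂ E = n →
      ∀ δ : ℝ, 0 < δ → δ < 1 → ∀ N : ℕ, 1 ≤ N →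
        (OpSpace.kE E N (1 - δ)⁻¹ : ENNReal) ≤
          ENNReal.ofReal ((1 + 2 * δ⁻¹) ^ (2 * n * N ^ 2))) ∧
    (∀ (H : Type u) [NormedAddCommGroup H] [InnerProductSpace ℂ H]
      (E : Submodule ℂ (OpSpace.B H)) [FiniteDimensional ℂ E] (C : ℝ), 1 < C →
        Filter.limsup
          (fun N : ℕ => ENNReal.log (OpSpace.kE E N C : ENNReal) / (((N : ℝ) ^ 2 : ℝ) : EReal))
          Filter.atTop < ⊤) ∧
    (∀ C : ℝ, 1 < C → ∃ b : ℝ, 0 < b ∧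
      ∀ (H : Type u) [NormedAddCommGroup H] [InnerProductSpace ℂ H]
        (E : Submodule ℂ (OpSpace.B H)) [FiniteDimensional ℂ E] (N : ℕ), 1 ≤ N →
        (OpSpace.kE E N C : ENNReal) ≤
          ENNReal.ofReal (Real.exp (b * Module.finrank ℂ E * N ^ 2))) := by
  refine ⟨?_, ?_, ?_⟩
  · rintro H _ _ E _ _ rfl δ hδ₀ hδ₁ N hN
    have : NeZero N := NeZero.of_pos hN
    exact OpSpace.kE_le_pow E N hδ₀ hδ₁
  · intro H _ _ E _ C hC
    have hsq : ∀ᶠ N : ℕ in Filter.atTop, (0 : ℝ) < (N : ℝ) ^ 2 := by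
      filter_upwards [Filter.eventually_gt_atTop 0] with N hN
      positivity
    have hexp : ∀ᶠ N : ℕ in Filter.atTop, (OpSpace.kE E N C : ENNReal) ≤
        ENNReal.ofReal (Real.exp (OpSpace.growthRate C * Module.finrank ℂ E * (N : ℝ) ^ 2)) := by
      filter_upwards [Filter.eventually_ne_atTop 0] with N hN
      have : NeZero N := ⟨hN⟩
      exact OpSpace.kE_le_exp E N hC
    exact (OpSpace.limsup_log_div_le_of_le_exp hsq hexp).trans_lt (EReal.coe_lt_top _)
  · intro C hC
    refine ⟨OpSpace.growthRate C, OpSpace.growthRate_pos hC, fun H _ _ E _ N hN => ?_⟩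
    have : NeZero N := NeZero.of_pos hN
    exact OpSpace.kE_le_exp E N hC

theorem mainTheorem9 :
    -- the upper bound for every `n`-dimensional operator space
    (∀ (H : Type u) [NormedAddCommGroup H] [InnerProductSpace ℂ H] [CompleteSpace H]
      (E : Submodule ℂ (OpSpace.B H)) [FiniteDimensional ℂ E] (n : ℕ),
      Module.finrank ℂ E = n →
      ∀ δ : ℝ, 0 < δ → δ < 1 → ∀ N : ℕ, 1 ≤ N →
        (OpSpace.kE E N (1 - δ)⁻¹ : ENNReal) ≤
          ENNReal.ofReal ((1 + 2 * δ⁻¹) ^ (2 * n * N ^ 2))) ∧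
    -- the growth in `N` for finite dimensional subspaces of an operator space
    (∀ (H : Type u) [NormedAddCommGroup H] [InnerProductSpace ℂ H] [CompleteSpace H]
      (X : Submodule ℂ (OpSpace.B H)), IsClosed (X : Set (OpSpace.B H)) →
      ∀ E : Submodule ℂ (OpSpace.B H), E ≤ X → FiniteDimensional ℂ E →
      ∀ C : ℝ, 1 < C →
        Filter.limsup
          (fun N : ℕ => ENNReal.log (OpSpace.kE E N C : ENNReal) / (((N : ℝ) ^ 2 : ℝ) : EReal))
          Filter.atTop < ⊤) ∧
    -- the order `exp (b n N ^ 2)` is the largest possible one, uniformly in `n`, `E` and `N`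
    (∀ C : ℝ, 1 < C → ∃ b : ℝ, 0 < b ∧
      ∀ (H : Type u) [NormedAddCommGroup H] [InnerProductSpace ℂ H] [CompleteSpace H]
        (E : Submodule ℂ (OpSpace.B H)) [FiniteDimensional ℂ E] (N : ℕ), 1 ≤ N →
        (OpSpace.kE E N C : ENNReal) ≤
          ENNReal.ofReal (Real.exp (b * Module.finrank ℂ E * N ^ 2))) := by
  obtain ⟨hpow, hlimsup, hexp⟩ := mainTheorem9_general.{u}
  exact ⟨fun H _ _ _ => hpow H, fun H _ _ _ _ _ E _ _ => hlimsup H E,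
    fun C hC => (hexp C hC).imp fun _ hb => ⟨hb.1, fun H _ _ _ => hb.2 H⟩⟩
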